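/- Write a permutation $\pi$ of $[n]=\{1,\dots,n\}$ in standard cycle form: every cycle (fixed points included) is written starting with its smallest element, and the cycles are listed in decreasing order of their smallest elements. Let $\Psi(\pi)$ be the word obtained by removing the parentheses. For a permutation $p=p_1p_2p_3$ of $\{1,2,3\}$, $\pi$ \emph{cyclically avoids} the pattern $p_1$–$p_2$–$p_3$ if there are no positions $i_1<i_2<i_3$ (adjacent or not) at which the letters of $\Psi(\pi)$ are in the same relative order as $p_1,p_2,p_3$. Let $f_p(0,m,n)$ be the number of permutations of $[n]$ with exactly $m$ cycles that cyclically avoid $p$. A Dyck path of length $n$ consists of $n$ steps $(1,1)$ and $n$ steps $(1,-1)$, starts at $(0,0)$, ends on the $x$-axis, and never goes below it; its returns are its visits to the $x$-axis other than the initial one. Let $d(m,n)$ be the number of Dyck paths of length $n$ with exactly $m$ returns. Theorem. For all integers $m,n\ge 0$, \[ f_{3\text{–}1\text{–}2}(0,m,n)=f_{2\text{–}3\text{–}1}(0,m,n)=f_{2\text{–}1\text{–}3}(0,m,n)=d(m,n), \] and whenever $m<2n$ (in particular whenever $n\ge1$ and $0\le m\le n$) this common number is the Catalan triangle number \[ d(m,n)=\frac{m}{2n-m}\binom{2n-m}{n}.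 \] -/

import Mathlib

namespace CyclicPattern

/-- `a` is the smallest element of its cycle in `π` (fixed points are cycles of length one). -/
def IsCycleMin {n : ℕ} (π : Equiv.Perm (Fin n)) (a : Fin n) : Prop :=
  ∀ b, π.SameCycle a b → a ≤ b

instance {n : ℕ} (π : Equiv.Perm (Fin n)) : DecidablePred (IsCycleMin π) := fun a =>
  inferInstanceAs (Decidable (∀ b, π.SameCycle a b → a ≤ b))

/-- The cycle of `π` through `a`, written from `a` on: `[a, π a, π (π a), …]`,
with as many entries as the cycle has elements. -/
def cycleWord {n : ℕ} (π : Equiv.Perm (Fin n)) (a : Fin n) : List (Fin n) :=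
  List.iterate π a (Finset.univ.filter fun b => π.SameCycle a b).card

/-- The standard cycle form of `π`: every cycle starts with its smallest element, and the cycles
are listed in decreasing order of their smallest elements. -/
def standardCycleForm {n : ℕ} (π : Equiv.Perm (Fin n)) : List (List (Fin n)) :=
  ((List.finRange n).reverse.filter fun a => IsCycleMin π a).map (cycleWord π)

/-- The number of cycles of `π`, fixed points included. -/
def numCycles {n : ℕ} (π : Equiv.Perm (Fin n)) : ℕ :=
  (standardCycleForm π).length

/-- The word obtained from the standard cycle form by removing the parentheses. -/
def cycleFormWord {n : ℕ} (π : Equiv.Perm (Fin n)) : List (Fin n) :=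
  (standardCycleForm π).flatten

/-- The positions `s 0 < s 1 < …` carry an occurrence in the word `w` of the pattern
`p 0 – p 1 – …`, in which no two letters are required to be adjacent. -/
def IsOccurrence {k n : ℕ} (p : Fin k → ℕ) (w : List (Fin n)) (s : Fin k ↪o Fin w.length) : Prop :=
  ∀ i j, w.get (s i) < w.get (s j) ↔ p i < p j

/-- `π` has no cyclic occurrence of the pattern `p`. -/
def CyclicallyAvoids {k n : ℕ} (p : Fin k → ℕ) (π : Equiv.Perm (Fin n)) : Prop :=
  ∀ s : Fin k ↪o Fin (cycleFormWord π).length, ¬ IsOccurrence p (cycleFormWord π) s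

/-- The number of permutations of an `n`-element chain that have `m` cycles and cyclically avoid
the pattern `p`. -/
noncomputable def avoidanceCount {k : ℕ} (p : Fin k → ℕ) (m n : ℕ) : ℕ :=
  Nat.card {π : Equiv.Perm (Fin n) // numCycles π = m ∧ CyclicallyAvoids p π}

/-- The number of returns of a Dyck path: its visits to the axis other than the initial one. -/
def numReturns (d : DyckWord) : ℕ :=
  ((Finset.Icc 1 d.toList.length).filter fun i =>
    (d.toList.take i).count DyckStep.U = (d.toList.take i).count DyckStep.D).card

/-- The number of Dyck paths with `n` up-steps and `n` down-steps that have `m` returns. -/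
noncomputable def dyckReturnCount (m n : ℕ) : ℕ :=
  Nat.card {d : DyckWord // d.semilength = n ∧ numReturns d = m}

end CyclicPattern

/-! All four families are counted by binary trees with `n` nodes, `m` of them on the right spine. In
standard cycle form the first letters of the cycles are exactly the left-to-right minima of the word
(`lrMinima_cycleFormWord`), and these show where the parentheses go. So the word determines the
permutation and every arrangement of the letters occurs (`exists_map_val_cycleFormWord_eq`): each
`f_p` counts `p`-avoiding words by left-to-right minima. Such a word splits, at its first letter
(2-3-1, 2-1-3) or at its smallest letter (3-1-2), into two avoiding words on intervals. If the lower
interval goes to the right subtree, the minima become the right spine (`card_words_eq`). For Dyck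
paths the first-return decomposition does the same with returns (`dyckReturnCount_eq`). The closed
form solves the recurrence `card_spineTrees_succ_succ`. -/

namespace CyclicPattern

open BinaryTree

/-! ### Counting binary trees by right spine -/

/-- The number of nodes on the path that starts at the root and always goes to the right. -/
def rightSpine : BinaryTree Unit → ℕ
  | .nil => 0
  | .node _ _ r => rightSpine r + 1

lemma rightSpine_le_numNodes (t : BinaryTree Unit) : rightSpine t ≤ t.numNodes := by
  induction t with
  | nil => simp [rightSpine]
  | node _ l r _ hr => simp only [rightSpine, numNodes]; omega

/-- The binary trees with `n` nodes whose right spine has `m` nodes. -/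
def spineTrees (m n : ℕ) : Finset (BinaryTree Unit) :=
  (treesOfNumNodesEq n).filter fun t => rightSpine t = m

lemma mem_spineTrees {m n : ℕ} {t : BinaryTree Unit} :
    t ∈ spineTrees m n ↔ t.numNodes = n ∧ rightSpine t = m := by
  simp [spineTrees]

lemma card_spineTrees_eq_zero {m n : ℕ} (h : n < m) : (spineTrees m n).card = 0 := by
  rw [Finset.card_eq_zero, Finset.eq_empty_iff_forall_notMem]
  intro t ht
  rw [mem_spineTrees] at ht
  have := rightSpine_le_numNodes t
  omega

lemma card_spineTrees_zero_zero : (spineTrees 0 0).card = 1 := by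
  rw [spineTrees, treesOfNumNodesEq_zero]
  simp [Finset.filter_singleton, rightSpine]

lemma card_spineTrees_zero_succ (n : ℕ) : (spineTrees 0 (n + 1)).card = 0 := by
  rw [Finset.card_eq_zero, Finset.eq_empty_iff_forall_notMem]
  rintro (_ | ⟨_, l, r⟩) ht <;> simp [mem_spineTrees, rightSpine] at ht

/-- The rotation that moves the root of the left subtree to the root. -/
def rotateRight : BinaryTree Unit → BinaryTree Unit
  | .node _ (.node _ a b) r => .node () a (.node () b r)
  | t => t

/-- The rotation that moves the root of the right subtree to the root. -/
def rotateLeft : BinaryTree Unit → BinaryTree Unit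
  | .node _ a (.node _ b r) => .node () (.node () a b) r
  | t => t

/-- If the root has no left child, deleting it loses one node and one spine node. Otherwise a right
rotation lengthens the spine by one, and is undone by a left rotation because a spine of `m + 2 ≥ 2`
nodes provides a right child. -/
lemma card_spineTrees_succ_succ (m n : ℕ) :
    (spineTrees (m + 1) (n + 1)).card =
      (spineTrees m n).card + (spineTrees (m + 2) (n + 1)).card := by
  rw [← Finset.card_filter_add_card_filter_not (fun t : BinaryTree Unit => t.left = .nil)]
  congr 1
  · refine Finset.card_nbij' BinaryTree.right (BinaryTree.node () .nil) ?_ ?_ ?_ ?_ <;>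
      simp only [Set.MapsTo, Set.LeftInvOn, Set.RightInvOn, Finset.mem_coe, Finset.mem_filter, mem_spineTrees]
    · rintro (_ | ⟨_, l, r⟩) ⟨ht, h⟩
      · simp at ht
      · obtain rfl : l = .nil := h
        simpa [rightSpine] using ht
    · intro t ht
      simpa [rightSpine] using ht
    · rintro (_ | ⟨_, l, r⟩) ⟨ht, h⟩
      · simp at ht
      · obtain rfl : l = .nil := h
        rfl
    · intro t _
      rfl
  · refine Finset.card_nbij' rotateRight rotateLeft ?_ ?_ ?_ ?_ <;>
      simp only [Set.MapsTo, Set.LeftInvOn, Set.RightInvOn, Finset.mem_coe, Finset.mem_filter, mem_spineTrees]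
    · rintro (_ | ⟨_, _ | ⟨_, a, b⟩, r⟩) ht <;>
        simp [rightSpine, rotateRight] at ht ⊢
      omega
    · rintro (_ | ⟨_, a, _ | ⟨_, b, r⟩⟩) ht <;>
        simp [rightSpine, rotateLeft] at ht ⊢
      omega
    · rintro (_ | ⟨_, _ | ⟨_, a, b⟩, r⟩) ht
      · rfl
      · exact absurd rfl ht.2
      · rfl
    · rintro (_ | ⟨_, a, _ | ⟨_, b, r⟩⟩) ht <;>
        simp [rightSpine, rotateRight, rotateLeft] at ht ⊢

lemma card_spineTrees_self (m : ℕ) : (spineTrees m m).card = 1 := by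
  induction m with
  | zero => exact card_spineTrees_zero_zero
  | succ m ih => rw [card_spineTrees_succ_succ, ih, card_spineTrees_eq_zero (by omega)]

/-- Writing `n = m + i` avoids truncated subtraction, and clearing the denominator covers `m = i =
0`. The recurrence gives `(m + 1, i + 1)` from `(m, i + 1)` and `(m + 2, i)`, hence an inner
induction on `m` inside one on `i` with `m` free. -/
lemma card_spineTrees_add (m i : ℕ) :
    ((m : ℚ) + 2 * i) * (spineTrees m (m + i)).card = m * (m + 2 * i).choose i := by
  induction i generalizing m with
  | zero => simp [card_spineTrees_self]
  | succ i ih =>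
    induction m with
    | zero => simp [card_spineTrees_zero_succ]
    | succ m ihm =>
      have hrec : (spineTrees (m + 1) (m + 1 + (i + 1))).card =
          (spineTrees m (m + (i + 1))).card + (spineTrees (m + 2) (m + 2 + i)).card := by
        rw [show m + 1 + (i + 1) = (m + (i + 1)) + 1 by ring, card_spineTrees_succ_succ,
          show m + (i + 1) + 1 = m + 2 + i by ring]
      have h2 := ih (m + 2)
      rw [show m + 2 + 2 * i = m + 2 * i + 2 by ring] at h2
      rw [show m + 2 * (i + 1) = m + 2 * i + 2 by ring] at ihm
      rw [show m + 1 + 2 * (i + 1) = m + 2 * i + 2 + 1 by ring, hrec]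
      have c1 : ((m + 2 * i + 2).choose (i + 1) : ℚ) * (i + 1) =
          (m + 2 * i + 2).choose i * (m + i + 2) := by
        have := Nat.choose_succ_right_eq (m + 2 * i + 2) i
        rw [show m + 2 * i + 2 - i = m + i + 2 by omega] at this
        exact_mod_cast this
      have c2 : ((m + 2 * i + 2 + 1).choose (i + 1) : ℚ) * (i + 1) =
          (m + 2 * i + 3) * (m + 2 * i + 2).choose i := by
        have := Nat.add_one_mul_choose_eq (m + 2 * i + 2) i
        exact_mod_cast this.symm
      push_cast at ihm h2 ⊢
      -- With `c1`, `c2` and the two induction hypotheses, every term becomes a rational multiple of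
      -- the single binomial `w`.
      generalize ((spineTrees m (m + (i + 1))).card : ℚ) = x at *
      generalize ((spineTrees (m + 2) (m + 2 + i)).card : ℚ) = y at *
      generalize ((m + 2 * i + 2).choose (i + 1) : ℚ) = u at *
      generalize ((m + 2 * i + 2 + 1).choose (i + 1) : ℚ) = v at *
      generalize ((m + 2 * i + 2).choose i : ℚ) = w at *
      have hi : ((i : ℚ) + 1) ≠ 0 := by positivity
      have hN : ((m : ℚ) + 2 * i + 2) ≠ 0 := by positivity
      obtain rfl : u = w * (m + i + 2) / (i + 1) := by rw [eq_div_iff hi, c1]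
      obtain rfl : v = (m + 2 * i + 3) * w / (i + 1) := by rw [eq_div_iff hi, c2]
      obtain rfl : x = m * (w * (m + i + 2) / (i + 1)) / (m + 2 * i + 2) := by
        rw [eq_div_iff hN, ← ihm]; ring
      obtain rfl : y = (m + 2) * w / (m + 2 * i + 2) := by
        rw [eq_div_iff hN, ← h2]; ring
      field_simp
      ring

theorem card_spineTrees_eq_div (m n : ℕ) (h : m < 2 * n) :
    ((spineTrees m n).card : ℚ) =
      (m : ℚ) / (2 * (n : ℚ) - (m : ℚ)) * ((2 * n - m).choose n : ℚ) := by
  rcases le_or_gt m n with hmn | hmn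
  · obtain ⟨i, rfl⟩ := Nat.exists_eq_add_of_le hmn
    have key := card_spineTrees_add m i
    have hpos : (0 : ℚ) < m + 2 * i := by exact_mod_cast (by omega : 0 < m + 2 * i)
    rw [show 2 * (m + i) - m = m + 2 * i by omega,
      show (m + 2 * i).choose (m + i) = (m + 2 * i).choose i from
        Nat.choose_symm_of_eq_add (by ring)]
    push_cast
    rw [show 2 * ((m : ℚ) + i) - m = m + 2 * i by ring, div_mul_eq_mul_div,
      eq_div_iff hpos.ne', ← key]
    ring
  -- For `n < m` both sides vanish, since `2 * n - m < n`.
  · rw [card_spineTrees_eq_zero hmn, Nat.choose_eq_zero_of_lt (by omega)]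
    simp

/-! ### Returns of Dyck paths -/

/-- The number of nonempty prefixes of `l` with as many up-steps as down-steps. -/
def balancedPrefixes (l : List DyckStep) : ℕ :=
  ∑ i ∈ Finset.range l.length,
    if (l.take (i + 1)).count DyckStep.U = (l.take (i + 1)).count DyckStep.D then 1 else 0

lemma numReturns_eq_balancedPrefixes (d : DyckWord) :
    numReturns d = balancedPrefixes d.toList := by
  rw [numReturns, balancedPrefixes, Finset.card_filter, Finset.range_eq_Ico,
    Finset.sum_Ico_add' (fun i => if (d.toList.take i).count DyckStep.U =
      (d.toList.take i).count DyckStep.D then 1 else 0) 0 d.toList.length 1]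
  rfl

lemma balancedPrefixes_append {l₁ l₂ : List DyckStep}
    (h : l₁.count DyckStep.U = l₁.count DyckStep.D) :
    balancedPrefixes (l₁ ++ l₂) = balancedPrefixes l₁ + balancedPrefixes l₂ := by
  rw [balancedPrefixes, List.length_append, Finset.sum_range_add]
  congr 1
  · refine Finset.sum_congr rfl fun i hi => ?_
    rw [Finset.mem_range] at hi
    rw [List.take_append_of_le_length (by omega)]
  · refine Finset.sum_congr rfl fun i hi => ?_
    rw [add_assoc, List.take_length_add_append, List.count_append, List.count_append, h]
    simp

/-- The first return of a nested path is its final step, so every shorter nonempty prefix has a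
surplus of up-steps. -/
lemma balancedPrefixes_nest (p : DyckWord) : balancedPrefixes p.nest.toList = 1 := by
  have hlen : p.nest.toList.length = p.toList.length + 1 + 1 := by simp [DyckWord.nest]
  rw [balancedPrefixes, hlen, Finset.sum_range_succ, Finset.sum_eq_zero, zero_add, if_pos]
  · rw [List.take_of_length_le hlen.le, p.nest.count_U_eq_count_D]
  · intro i hi
    rw [Finset.mem_range, ← DyckWord.firstReturn_nest] at hi
    exact if_neg (DyckWord.count_D_lt_count_U_of_lt_firstReturn hi).ne'

lemma numReturns_nest_add (p q : DyckWord) : numReturns (p.nest + q) = numReturns q + 1 := by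
  rw [numReturns_eq_balancedPrefixes, numReturns_eq_balancedPrefixes,
    show (p.nest + q).toList = p.nest.toList ++ q.toList from rfl,
    balancedPrefixes_append p.nest.count_U_eq_count_D, balancedPrefixes_nest, add_comm]

lemma numReturns_ofTree (t : BinaryTree Unit) : numReturns (DyckWord.ofTree t) = rightSpine t := by
  induction t with
  | nil => rfl
  | node _ l r _ hr => rw [DyckWord.ofTree, numReturns_nest_add, hr, rightSpine]

theorem dyckReturnCount_eq (m n : ℕ) : dyckReturnCount m n = (spineTrees m n).card := by
  rw [dyckReturnCount, ← Nat.card_eq_finsetCard]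
  refine Nat.card_congr (DyckWord.equivTree.subtypeEquiv fun d => ?_)
  rw [mem_spineTrees, DyckWord.equivTree_apply, DyckWord.numNodes_toTree,
    ← numReturns_ofTree, DyckWord.ofTree_toTree]

end CyclicPattern
namespace CyclicPattern

open BinaryTree List

/-! ### Left-to-right minima and splitting of intervals -/

/-- The number of left-to-right minima of `w` that are below `b`. -/
def lrMinima : ℕ → List ℕ → ℕ
  | _, [] => 0
  | b, a :: w => if a < b then lrMinima a w + 1 else lrMinima b w

lemma lrMinima_append_of_forall_ge {b : ℕ} {v : List ℕ} (hv : ∀ x ∈ v, b ≤ x) (w : List ℕ) :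
    lrMinima b (v ++ w) = lrMinima b w := by
  induction v with
  | nil => rfl
  | cons a v ih =>
    rw [forall_mem_cons] at hv
    rw [cons_append, lrMinima, if_neg (by omega), ih hv.2]

lemma lrMinima_eq_zero {b : ℕ} {v : List ℕ} (hv : ∀ x ∈ v, b ≤ x) : lrMinima b v = 0 := by
  simpa [lrMinima] using lrMinima_append_of_forall_ge hv []

lemma lrMinima_append_of_forall_ge_right {b c : ℕ} {w : List ℕ} (hw : ∀ x ∈ w, c ≤ x)
    {v : List ℕ} (hv : ∀ x ∈ v, x < c) (hbc : b ≤ c) :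
    lrMinima b (v ++ w) = lrMinima b v := by
  induction v generalizing b with
  | nil => exact lrMinima_eq_zero fun x hx => hbc.trans (hw x hx)
  | cons a v ih =>
    rw [forall_mem_cons] at hv
    rw [cons_append, lrMinima, lrMinima, ih hv.2 hbc, ih hv.2 hv.1.le]

lemma lrMinima_append_cons {b o : ℕ} (hob : o < b) {v : List ℕ} (hv : ∀ x ∈ v, o < x)
    {w : List ℕ} (hw : ∀ x ∈ w, o ≤ x) : lrMinima b (v ++ o :: w) = lrMinima b v + 1 := by
  induction v generalizing b with
  | nil => simp [lrMinima, hob, lrMinima_eq_zero hw]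
  | cons a v ih =>
    rw [forall_mem_cons] at hv
    rw [cons_append, lrMinima, lrMinima, ih hob hv.2, ih hv.1 hv.2]
    split_ifs <;> rfl

/-- Sorting `v` and `w` separately and concatenating gives a sorted list; a sorted arrangement is
unique, so it is the range itself, cut after `v.length` letters. -/
lemma perm_range'_of_append {v w : List ℕ} {s n : ℕ} (h : v ++ w ~ range' s n)
    (hlt : ∀ x ∈ v, ∀ y ∈ w, x < y) :
    v ~ range' s v.length ∧ w ~ range' (s + v.length) w.length := by
  have hn : v.length + w.length = n := by simpa using h.length_eq
  have hp : insertionSort (· ≤ ·) v ++ insertionSort (· ≤ ·) w ~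
      range' s v.length ++ range' (s + v.length) w.length := by
    rw [range'_append_1, hn]
    exact ((perm_insertionSort _ _).append (perm_insertionSort _ _)).trans h
  have hs : (insertionSort (· ≤ ·) v ++ insertionSort (· ≤ ·) w).Pairwise (· ≤ ·) := by
    refine pairwise_append.2 ⟨pairwise_insertionSort _ _, pairwise_insertionSort _ _, ?_⟩
    intro x hx y hy
    rw [mem_insertionSort] at hx hy
    exact (hlt x hx y hy).le
  have hr : (range' s v.length ++ range' (s + v.length) w.length).Pairwise (· ≤ ·) := by
    rw [range'_append_1]
    exact pairwise_le_range'
  have heq := hp.eq_of_pairwise' hs hr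
  obtain ⟨h1, h2⟩ := append_inj heq (by simp)
  exact ⟨h1 ▸ (perm_insertionSort _ _).symm, h2 ▸ (perm_insertionSort _ _).symm⟩

lemma perm_range'_of_append_cons {v w : List ℕ} {k s n : ℕ} (h : v ++ k :: w ~ range' s n)
    (hv : ∀ x ∈ v, x < k) (hw : ∀ x ∈ w, k < x) :
    v ~ range' s v.length ∧ k = s + v.length ∧ w ~ range' (s + v.length + 1) w.length := by
  obtain ⟨h1, h2⟩ := perm_range'_of_append h fun x hx y hy => by
    rcases mem_cons.1 hy with rfl | hy
    · exact hv x hx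
    · exact (hv x hx).trans (hw y hy)
  rw [← singleton_append] at h2
  obtain ⟨h3, h4⟩ := perm_range'_of_append h2 fun x hx y hy => by
    rw [mem_singleton] at hx
    exact hx ▸ hw y hy
  exact ⟨h1, by simpa using h3, by simpa using h4⟩

lemma range'_perm_cons_append (s a b : ℕ) :
    (s + a) :: (range' s a ++ range' (s + a + 1) b) ~ range' s (b + a + 1) := by
  refine perm_middle.symm.trans ?_
  rw [← range'_succ, range'_append_1, show a + (b + 1) = b + a + 1 by ring]

lemma exists_append_of_pairwise (R : ℕ → Prop) [DecidablePred R] {w : List ℕ}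
    (h : w.Pairwise fun x y => R y → R x) :
    ∃ u v, w = u ++ v ∧ (∀ x ∈ u, R x) ∧ ∀ x ∈ v, ¬ R x := by
  induction w with
  | nil => exact ⟨[], [], by simp⟩
  | cons a w ih =>
    rw [pairwise_cons] at h
    by_cases ha : R a
    · obtain ⟨u, v, rfl, hu, hv⟩ := ih h.2
      exact ⟨a :: u, v, rfl, forall_mem_cons.2 ⟨ha, hu⟩, hv⟩
    · exact ⟨[], a :: w, rfl, by simp, forall_mem_cons.2 ⟨ha, fun x hx hRx => ha (h.1 x hx hRx)⟩⟩

/-! ### Avoiding words encoded by binary trees -/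

/-- No letter is followed by a larger and then by a smaller one. -/
abbrev Avoids231 (w : List ℕ) : Prop := w.Triplewise fun x y z => ¬ (z < x ∧ x < y)

/-- No letter is followed by a smaller and then by a larger one. -/
abbrev Avoids213 (w : List ℕ) : Prop := w.Triplewise fun x y z => ¬ (y < x ∧ x < z)

/-- No letter is followed by two smaller ones in increasing order. -/
abbrev Avoids312 (w : List ℕ) : Prop := w.Triplewise fun x y z => ¬ (y < z ∧ z < x)

/-- The arrangement of `s, …, s + t.numNodes - 1` that avoids `2-3-1` and is encoded by `t`. -/
def word231 : ℕ → BinaryTree Unit → List ℕ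
  | _, .nil => []
  | s, .node _ l r =>
    (s + r.numNodes) :: (word231 s r ++ word231 (s + r.numNodes + 1) l)

/-- The arrangement of `s, …, s + t.numNodes - 1` that avoids `2-1-3` and is encoded by `t`. -/
def word213 : ℕ → BinaryTree Unit → List ℕ
  | _, .nil => []
  | s, .node _ l r =>
    (s + r.numNodes) :: (word213 (s + r.numNodes + 1) l ++ word213 s r)

/-- The arrangement of `s, …, s + t.numNodes - 1` that avoids `3-1-2` and is encoded by `t`. -/
def word312 : ℕ → BinaryTree Unit → List ℕ
  | _, .nil => []
  | s, .node _ l r => word312 (s + 1) r ++ s :: word312 (s + 1 + r.numNodes) l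

lemma word231_perm (s : ℕ) (t : BinaryTree Unit) : word231 s t ~ range' s t.numNodes := by
  induction t generalizing s with
  | nil => simp [word231]
  | node _ l r hl hr =>
    exact (((hr _).append (hl _)).cons _).trans (range'_perm_cons_append _ _ _)

lemma word213_perm (s : ℕ) (t : BinaryTree Unit) : word213 s t ~ range' s t.numNodes := by
  induction t generalizing s with
  | nil => simp [word213]
  | node _ l r hl hr =>
    exact ((perm_append_comm.trans ((hr _).append (hl _))).cons _).trans
      (range'_perm_cons_append _ _ _)

lemma word312_perm (s : ℕ) (t : BinaryTree Unit) : word312 s t ~ range' s t.numNodes := by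
  induction t generalizing s with
  | nil => simp [word312]
  | node _ l r hl hr =>
    refine perm_middle.trans ((((hr _).append (hl _)).cons _).trans ?_)
    rw [range'_append_1, numNodes, add_comm l.numNodes, range'_succ]

lemma mem_word231 {s x : ℕ} {t : BinaryTree Unit} :
    x ∈ word231 s t ↔ s ≤ x ∧ x < s + t.numNodes := by
  rw [(word231_perm s t).mem_iff, mem_range'_1]

lemma mem_word213 {s x : ℕ} {t : BinaryTree Unit} :
    x ∈ word213 s t ↔ s ≤ x ∧ x < s + t.numNodes := by
  rw [(word213_perm s t).mem_iff, mem_range'_1]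

lemma mem_word312 {s x : ℕ} {t : BinaryTree Unit} :
    x ∈ word312 s t ↔ s ≤ x ∧ x < s + t.numNodes := by
  rw [(word312_perm s t).mem_iff, mem_range'_1]

lemma length_word231 (s : ℕ) (t : BinaryTree Unit) : (word231 s t).length = t.numNodes := by
  simpa using (word231_perm s t).length_eq

lemma length_word213 (s : ℕ) (t : BinaryTree Unit) : (word213 s t).length = t.numNodes := by
  simpa using (word213_perm s t).length_eq

lemma length_word312 (s : ℕ) (t : BinaryTree Unit) : (word312 s t).length = t.numNodes := by
  simpa using (word312_perm s t).length_eq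

/-- The root letter is a minimum and becomes the exact upper bound for the letters of `r`, so the
hypothesis reproduces itself along the right spine; the letters of `l` exceed the root letter and
contribute nothing. -/
lemma lrMinima_word231 {b s : ℕ} {t : BinaryTree Unit} (h : s + t.numNodes ≤ b) :
    lrMinima b (word231 s t) = rightSpine t := by
  induction t generalizing b s with
  | nil => rfl
  | node _ l r hl hr =>
    rw [numNodes] at h
    rw [word231, lrMinima, if_pos (by omega), rightSpine,
      lrMinima_append_of_forall_ge_right (c := s + r.numNodes), hr le_rfl]
    · intro x hx
      rw [mem_word231] at hx
      omega
    · intro x hx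
      exact (mem_word231.1 hx).2
    · exact le_rfl

lemma lrMinima_word213 {b s : ℕ} {t : BinaryTree Unit} (h : s + t.numNodes ≤ b) :
    lrMinima b (word213 s t) = rightSpine t := by
  induction t generalizing b s with
  | nil => rfl
  | node _ l r hl hr =>
    rw [numNodes] at h
    rw [word213, lrMinima, if_pos (by omega), rightSpine, lrMinima_append_of_forall_ge, hr le_rfl]
    intro x hx
    rw [mem_word213] at hx
    omega

/-- Here `r` comes first and keeps the bound `b`; the smallest letter `s` then adds the last
minimum. -/
lemma lrMinima_word312 {b s : ℕ} {t : BinaryTree Unit} (h : s + t.numNodes ≤ b) :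
    lrMinima b (word312 s t) = rightSpine t := by
  induction t generalizing b s with
  | nil => rfl
  | node _ l r hl hr =>
    rw [numNodes] at h
    rw [word312, lrMinima_append_cons (by omega), hr (by omega), rightSpine]
    all_goals
      intro x hx
      rw [mem_word312] at hx
      omega

lemma avoids231_word231 (s : ℕ) (t : BinaryTree Unit) : Avoids231 (word231 s t) := by
  induction t generalizing s with
  | nil => exact .nil
  | node _ l r hl hr =>
    refine triplewise_cons.2 ⟨pairwise_append.2 ⟨?_, ?_, ?_⟩,
      triplewise_append.2 ⟨hr _, hl _, ?_, ?_⟩⟩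
    · refine pairwise_of_forall_mem_list fun x hx y hy => ?_
      rw [mem_word231] at hx hy
      omega
    · refine pairwise_of_forall_mem_list fun x hx y hy => ?_
      rw [mem_word231] at hx hy
      omega
    · intro x hx y hy
      rw [mem_word231] at hx hy
      omega
    · refine fun z hz => pairwise_of_forall_mem_list fun x hx y hy => ?_
      rw [mem_word231] at hx hy hz
      omega
    · refine fun z hz => pairwise_of_forall_mem_list fun x hx y hy => ?_
      rw [mem_word231] at hx hy hz
      omega

lemma avoids213_word213 (s : ℕ) (t : BinaryTree Unit) : Avoids213 (word213 s t) := by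
  induction t generalizing s with
  | nil => exact .nil
  | node _ l r hl hr =>
    refine triplewise_cons.2 ⟨pairwise_append.2 ⟨?_, ?_, ?_⟩,
      triplewise_append.2 ⟨hl _, hr _, ?_, ?_⟩⟩
    · refine pairwise_of_forall_mem_list fun x hx y hy => ?_
      rw [mem_word213] at hx hy
      omega
    · refine pairwise_of_forall_mem_list fun x hx y hy => ?_
      rw [mem_word213] at hx hy
      omega
    · intro x hx y hy
      rw [mem_word213] at hx hy
      omega
    · refine fun z hz => pairwise_of_forall_mem_list fun x hx y hy => ?_
      rw [mem_word213] at hx hy hz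
      omega
    · refine fun z hz => pairwise_of_forall_mem_list fun x hx y hy => ?_
      rw [mem_word213] at hx hy hz
      omega

lemma avoids312_word312 (s : ℕ) (t : BinaryTree Unit) : Avoids312 (word312 s t) := by
  induction t generalizing s with
  | nil => exact .nil
  | node _ l r hl hr =>
    refine triplewise_append.2 ⟨hr _, triplewise_cons.2 ⟨?_, hl _⟩, ?_, ?_⟩
    · refine pairwise_of_forall_mem_list fun x hx y hy => ?_
      rw [mem_word312] at hx hy
      omega
    · refine fun z hz => pairwise_of_forall_mem_list fun x hx y hy => ?_
      rw [mem_cons, mem_word312] at hx hy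
      rw [mem_word312] at hz
      omega
    · refine fun z hz => pairwise_of_forall_mem_list fun x hx y hy => ?_
      rw [mem_cons, mem_word312] at hz
      rw [mem_word312] at hx hy
      omega

lemma word231_injective (s : ℕ) : Function.Injective (word231 s) := by
  intro t
  induction t generalizing s with
  | nil => rintro (_ | ⟨_, l', r'⟩) h <;> simp [word231] at h ⊢
  | node _ l r hl hr =>
    rintro (_ | ⟨_, l', r'⟩) h
    · simp [word231] at h
    · obtain ⟨h1, h2⟩ := cons.inj h
      have h1 := Nat.add_left_cancel h1
      obtain ⟨h3, h4⟩ := append_inj h2 (by simp [length_word231, h1])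
      rw [h1] at h4
      rw [hr _ h3, hl _ h4]

lemma word213_injective (s : ℕ) : Function.Injective (word213 s) := by
  intro t
  induction t generalizing s with
  | nil => rintro (_ | ⟨_, l', r'⟩) h <;> simp [word213] at h ⊢
  | node _ l r hl hr =>
    rintro (_ | ⟨_, l', r'⟩) h
    · simp [word213] at h
    · obtain ⟨h1, h2⟩ := cons.inj h
      have h1 := Nat.add_left_cancel h1
      obtain ⟨h3, h4⟩ := append_inj' h2 (by simp [length_word213, h1])
      rw [h1] at h3
      rw [hr _ h4, hl _ h3]

lemma word312_injective (s : ℕ) : Function.Injective (word312 s) := by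
  intro t
  induction t generalizing s with
  | nil => rintro (_ | ⟨_, l', r'⟩) h <;> simp [word312] at h ⊢
  | node _ l r hl hr =>
    rintro (_ | ⟨_, l', r'⟩) h
    · simp [word312] at h
    · have hs : ∀ t, s ∉ word312 (s + 1) t := fun t hst => by
        have := (mem_word312.1 hst).1
        omega
      -- The cut between the subtrees is read off from the position of the smallest letter.
      have key : (word312 (s + 1) r).length = (word312 (s + 1) r').length := by
        have := congrArg (idxOf s) h
        simpa [word312, idxOf_append_of_notMem (hs _)] using this
      obtain ⟨h3, h4⟩ := append_inj h key
      rw [length_word312, length_word312] at key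
      have h5 := (cons.inj h4).2
      rw [key] at h5
      rw [hr _ h3, hl _ h5]

lemma exists_word231_eq {s n : ℕ} {w : List ℕ} (hp : w ~ range' s n) (hw : Avoids231 w) :
    ∃ t, word231 s t = w := by
  induction n using Nat.strong_induction_on generalizing s w with
  | _ n ih =>
    rcases w with _ | ⟨k, w⟩
    · exact ⟨.nil, rfl⟩
    obtain ⟨hk, hw⟩ := triplewise_cons.1 hw
    have hnd : (k :: w).Nodup := hp.nodup_iff.2 nodup_range'
    have hkw : ∀ x ∈ w, x ≠ k := fun x hx h => (nodup_cons.1 hnd).1 (h ▸ hx)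
    -- A larger letter before a smaller one would form 2-3-1 with `k`, so the letters below `k` form
    -- a prefix.
    obtain ⟨u, v, rfl, hu, hv⟩ := exists_append_of_pairwise (· < k) (w := w)
      (hk.imp_of_mem fun hx hy h hyk => by
        have := hkw _ hx
        have := hkw _ hy
        omega)
    obtain ⟨h1, h2, h3⟩ := perm_range'_of_append_cons (perm_middle.trans hp) hu fun x hx =>
      lt_of_le_of_ne (not_lt.1 (hv x hx)) (hkw x (mem_append_right _ hx)).symm
    have hlen := hp.length_eq
    simp only [length_cons, length_append, length_range'] at hlen
    obtain ⟨hwu, hwv, -⟩ := triplewise_append.1 hw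
    obtain ⟨r, hr⟩ := ih _ (by omega) h1 hwu
    obtain ⟨l, hl⟩ := ih _ (by omega) h3 hwv
    have hrn : r.numNodes = u.length := by rw [← length_word231 s, hr]
    exact ⟨.node () l r, by rw [word231, hrn, hr, hl, h2]⟩

lemma exists_word213_eq {s n : ℕ} {w : List ℕ} (hp : w ~ range' s n) (hw : Avoids213 w) :
    ∃ t, word213 s t = w := by
  induction n using Nat.strong_induction_on generalizing s w with
  | _ n ih =>
    rcases w with _ | ⟨k, w⟩
    · exact ⟨.nil, rfl⟩
    obtain ⟨hk, hw⟩ := triplewise_cons.1 hw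
    have hnd : (k :: w).Nodup := hp.nodup_iff.2 nodup_range'
    have hkw : ∀ x ∈ w, x ≠ k := fun x hx h => (nodup_cons.1 hnd).1 (h ▸ hx)
    -- A smaller letter before a larger one would form 2-1-3 with `k`, so the letters above `k` come
    -- first.
    obtain ⟨v, u, rfl, hv, hu⟩ := exists_append_of_pairwise (k < ·) (w := w)
      (hk.imp_of_mem fun hx hy h hyk => by
        have := hkw _ hx
        have := hkw _ hy
        omega)
    obtain ⟨h1, h2, h3⟩ := perm_range'_of_append_cons (v := u) (w := v)
      (perm_middle.trans ((perm_append_comm.cons _).trans hp))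
      (fun x hx => lt_of_le_of_ne (not_lt.1 (hu x hx)) (hkw x (mem_append_right _ hx))) hv
    have hlen := hp.length_eq
    simp only [length_cons, length_append, length_range'] at hlen
    obtain ⟨hwv, hwu, -⟩ := triplewise_append.1 hw
    obtain ⟨r, hr⟩ := ih _ (by omega) h1 hwu
    obtain ⟨l, hl⟩ := ih _ (by omega) h3 hwv
    have hrn : r.numNodes = u.length := by rw [← length_word213 s, hr]
    exact ⟨.node () l r, by rw [word213, hrn, hr, hl, h2]⟩

lemma exists_word312_eq {s n : ℕ} {w : List ℕ} (hp : w ~ range' s n) (hw : Avoids312 w) :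
    ∃ t, word312 s t = w := by
  induction n using Nat.strong_induction_on generalizing s w with
  | _ n ih =>
    rcases n with _ | n
    · rw [range'_zero, perm_nil] at hp
      exact ⟨.nil, hp.symm⟩
    obtain ⟨u, v, rfl⟩ := append_of_mem (hp.mem_iff.2 (mem_range'_1.2 ⟨le_rfl, by omega⟩) : s ∈ w)
    have hp' : u ++ v ~ range' (s + 1) n := by
      have := perm_middle.symm.trans hp
      rw [range'_succ] at this
      exact this.cons_inv
    have hs : ∀ x ∈ u ++ v, s < x := fun x hx => (mem_range'_1.1 (hp'.mem_iff.1 hx)).1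
    have hnd : (u ++ v).Nodup := hp'.nodup_iff.2 nodup_range'
    obtain ⟨hwu, hwv, huv, -⟩ := triplewise_append.1 hw
    -- If `x` before `s` exceeded `y` after it, then `x`, `s`, `y` would form 3-1-2.
    obtain ⟨h1, h2⟩ := perm_range'_of_append hp' fun x hx y hy => by
      have h3 := (pairwise_cons.1 (huv x hx)).1 y hy
      have h4 := hs y (mem_append_right _ hy)
      have h5 : x ≠ y := (nodup_append.1 hnd).2.2 x hx y hy
      omega
    have hlen := hp'.length_eq
    simp only [length_append, length_range'] at hlen
    obtain ⟨r, hr⟩ := ih _ (by omega) h1 hwu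
    obtain ⟨l, hl⟩ := ih _ (by omega) h2 (triplewise_cons.1 hwv).2
    have hrn : r.numNodes = u.length := by rw [← length_word312 (s + 1), hr]
    exact ⟨.node () l r, by rw [word312, hrn, hr, hl]⟩

/-- A bijective encoding of words by trees that turns the right spine into the left-to-right
minima turns the count of words by left-to-right minima into a count of trees. -/
lemma card_words_eq {P : List ℕ → Prop} {f : BinaryTree Unit → List ℕ}
    (hperm : ∀ t, f t ~ range' 0 t.numNodes) (hP : ∀ t, P (f t)) (hf : Function.Injective f)
    (hsurj : ∀ n w, w ~ range' 0 n → P w → ∃ t, f t = w)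
    (hmin : ∀ t, lrMinima t.numNodes (f t) = rightSpine t) (m n : ℕ) :
    Nat.card {w : List ℕ // w ~ range' 0 n ∧ lrMinima n w = m ∧ P w} = (spineTrees m n).card := by
  rw [← Nat.card_eq_finsetCard]
  symm
  have hmem : ∀ t ∈ spineTrees m n, f t ~ range' 0 n ∧ lrMinima n (f t) = m ∧ P (f t) := by
    intro t ht
    obtain ⟨rfl, rfl⟩ := mem_spineTrees.1 ht
    exact ⟨hperm t, hmin t, hP t⟩
  refine Nat.card_congr (Equiv.ofBijective (fun t => ⟨f t.1, hmem t.1 t.2⟩) ⟨?_, ?_⟩)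
  · exact fun t t' h => Subtype.ext (hf (congrArg Subtype.val h))
  · rintro ⟨w, hw, hm, hPw⟩
    obtain ⟨t, rfl⟩ := hsurj n w hw hPw
    have hn : t.numNodes = n := by simpa using (hperm t).length_eq.symm.trans hw.length_eq
    exact ⟨⟨t, mem_spineTrees.2 ⟨hn, by rw [← hmin, hn, hm]⟩⟩, rfl⟩

theorem card_avoids231 (m n : ℕ) :
    Nat.card {w : List ℕ // w ~ range' 0 n ∧ lrMinima n w = m ∧ Avoids231 w} =
      (spineTrees m n).card :=
  card_words_eq (word231_perm 0) (avoids231_word231 0) (word231_injective 0)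
    (fun _ _ => exists_word231_eq) (fun _ => lrMinima_word231 (by omega)) m n

theorem card_avoids213 (m n : ℕ) :
    Nat.card {w : List ℕ // w ~ range' 0 n ∧ lrMinima n w = m ∧ Avoids213 w} =
      (spineTrees m n).card :=
  card_words_eq (word213_perm 0) (avoids213_word213 0) (word213_injective 0)
    (fun _ _ => exists_word213_eq) (fun _ => lrMinima_word213 (by omega)) m n

theorem card_avoids312 (m n : ℕ) :
    Nat.card {w : List ℕ // w ~ range' 0 n ∧ lrMinima n w = m ∧ Avoids312 w} =
      (spineTrees m n).card :=
  card_words_eq (word312_perm 0) (avoids312_word312 0) (word312_injective 0)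
    (fun _ _ => exists_word312_eq) (fun _ => lrMinima_word312 (by omega)) m n

end CyclicPattern
namespace CyclicPattern

open List

/-! ### The standard cycle form as a bijection onto arrangements -/

section CycleForm

variable {n : ℕ} (π : Equiv.Perm (Fin n))

lemma isCycleOn_filter_sameCycle (a : Fin n) :
    π.IsCycleOn ((Finset.univ.filter fun b => π.SameCycle a b : Finset (Fin n)) : Set (Fin n)) := by
  refine ⟨⟨fun b hb => ?_, π.injective.injOn, fun b hb => ⟨π⁻¹ b, ?_, by simp⟩⟩,
    fun b hb c hc => ?_⟩
  · simpa using hb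
  · simpa using hb
  · simp only [Finset.coe_filter, Finset.mem_univ, true_and, Set.mem_ofPred_eq] at hb hc
    exact hb.symm.trans hc

lemma mem_filter_sameCycle_self (a : Fin n) :
    a ∈ Finset.univ.filter fun b => π.SameCycle a b := by
  simp [Equiv.Perm.SameCycle.refl]

lemma mem_cycleWord {a b : Fin n} : b ∈ cycleWord π a ↔ π.SameCycle a b := by
  rw [cycleWord, mem_iterate]
  constructor
  · rintro ⟨i, -, rfl⟩
    exact ⟨i, by rw [zpow_natCast, Equiv.Perm.coe_pow]⟩
  · intro h
    obtain ⟨i, hi, hib⟩ := (isCycleOn_filter_sameCycle π a).exists_pow_eq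
      (mem_filter_sameCycle_self π a) (b := b) (by simpa using h)
    exact ⟨i, hi, by rw [← hib, Equiv.Perm.coe_pow]⟩

lemma nodup_cycleWord (a : Fin n) : (cycleWord π a).Nodup := by
  rw [cycleWord, nodup_iff_injective_get]
  intro i j hij
  have hi := i.2.trans_eq (length_iterate _ _ _)
  have hj := j.2.trans_eq (length_iterate _ _ _)
  rw [get_eq_getElem, get_eq_getElem, getElem_iterate, getElem_iterate, ← Equiv.Perm.coe_pow,
    ← Equiv.Perm.coe_pow, (isCycleOn_filter_sameCycle π a).pow_apply_eq_pow_apply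
      (mem_filter_sameCycle_self π a)] at hij
  exact Fin.ext (hij.eq_of_lt_of_lt hi hj)

lemma exists_cycleWord_eq_cons (a : Fin n) : ∃ t, cycleWord π a = a :: t := by
  obtain ⟨k, hk⟩ := Nat.exists_eq_succ_of_ne_zero
    (Finset.card_ne_zero_of_mem (mem_filter_sameCycle_self π a))
  exact ⟨_, by rw [cycleWord, hk, Nat.succ_eq_add_one, iterate]⟩

variable {π} in
lemma IsCycleMin.exists_cycleWord_eq_cons {a : Fin n} (ha : IsCycleMin π a) :
    ∃ t, cycleWord π a = a :: t ∧ ∀ x ∈ t, a < x := by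
  obtain ⟨t, ht⟩ := CyclicPattern.exists_cycleWord_eq_cons π a
  have hnd := nodup_cycleWord π a
  rw [ht, nodup_cons] at hnd
  refine ⟨t, ht, fun x hx => lt_of_le_of_ne (ha x ?_) fun h => hnd.1 (h ▸ hx)⟩
  rw [← mem_cycleWord, ht]
  exact mem_cons_of_mem _ hx

lemma exists_isCycleMin_sameCycle (x : Fin n) : ∃ a, IsCycleMin π a ∧ π.SameCycle a x := by
  obtain ⟨a, ha, hmin⟩ := (Finset.univ.filter fun b => π.SameCycle x b).exists_min_image id
    ⟨x, mem_filter_sameCycle_self π x⟩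
  simp only [Finset.mem_filter, Finset.mem_univ, true_and, id] at ha hmin
  exact ⟨a, fun b hb => hmin b (ha.trans hb), ha.symm⟩

/-- The smallest elements of the cycles of `π`, in decreasing order. -/
abbrev cycleMins : List (Fin n) := (finRange n).reverse.filter fun a => IsCycleMin π a

lemma mem_cycleMins {a : Fin n} : a ∈ cycleMins π ↔ IsCycleMin π a := by
  simp

lemma pairwise_cycleMins : (cycleMins π).Pairwise (· > ·) :=
  (pairwise_reverse.2 (pairwise_lt_finRange n)).filter _

lemma cycleFormWord_eq : cycleFormWord π = ((cycleMins π).map (cycleWord π)).flatten := rfl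

lemma numCycles_eq : numCycles π = (cycleMins π).length := by
  rw [numCycles, standardCycleForm, length_map]

lemma mem_cycleFormWord (x : Fin n) : x ∈ cycleFormWord π := by
  obtain ⟨a, ha, hx⟩ := exists_isCycleMin_sameCycle π x
  rw [cycleFormWord_eq, mem_flatten]
  exact ⟨_, mem_map_of_mem ((mem_cycleMins π).2 ha), (mem_cycleWord π).2 hx⟩

lemma nodup_cycleFormWord : (cycleFormWord π).Nodup := by
  rw [cycleFormWord_eq, nodup_flatten]
  constructor
  · intro l hl
    obtain ⟨a, -, rfl⟩ := mem_map.1 hl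
    exact nodup_cycleWord π a
  · refine pairwise_map.2 ((pairwise_cycleMins π).imp_of_mem fun {a b} ha hb hab => ?_)
    rw [mem_cycleMins] at ha hb
    intro x hxa hxb
    rw [mem_cycleWord] at hxa hxb
    exact absurd (ha b (hxa.trans hxb.symm)) (not_le.2 hab)

lemma map_val_cycleFormWord_perm : (cycleFormWord π).map Fin.val ~ range' 0 n := by
  rw [← range_eq_range', ← map_coe_finRange_eq_range]
  refine Perm.map _ ((perm_ext_iff_of_nodup (nodup_cycleFormWord π) (nodup_finRange n)).2 ?_)
  exact fun x => by simp [mem_cycleFormWord]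

end CycleForm

/-- Each block head is below all earlier heads, hence a new minimum; the rest of its block lies
above it. -/
lemma lrMinima_flatten {n b : ℕ} {L : List (Fin n)} {c : Fin n → List (Fin n)}
    (hL : L.Pairwise (· > ·)) (hc : ∀ a ∈ L, ∃ t, c a = a :: t ∧ ∀ x ∈ t, a < x)
    (hb : ∀ a ∈ L, a.val < b) :
    lrMinima b ((L.map c).flatten.map Fin.val) = L.length := by
  induction L generalizing b with
  | nil => rfl
  | cons a L ih =>
    rw [pairwise_cons] at hL
    rw [forall_mem_cons] at hc hb
    obtain ⟨t, ht, hat⟩ := hc.1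
    rw [map_cons, flatten_cons, ht, cons_append, map_cons, lrMinima, if_pos hb.1, map_append,
      lrMinima_append_of_forall_ge, ih hL.2 hc.2 hL.1, length_cons]
    intro x hx
    obtain ⟨y, hy, rfl⟩ := mem_map.1 hx
    exact (hat y hy).le

/-- The parentheses can be restored: a block with head `a` continues while letters exceed `a`,
because the next head is smaller. -/
lemma eq_of_flatten_eq {n : ℕ} {L L' : List (Fin n)} {c c' : Fin n → List (Fin n)}
    (hL : L.Pairwise (· > ·)) (hc : ∀ a ∈ L, ∃ t, c a = a :: t ∧ ∀ x ∈ t, a < x)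
    (hL' : L'.Pairwise (· > ·)) (hc' : ∀ a ∈ L', ∃ t, c' a = a :: t ∧ ∀ x ∈ t, a < x)
    (h : (L.map c).flatten = (L'.map c').flatten) : L = L' ∧ ∀ a ∈ L, c a = c' a := by
  induction L generalizing L' with
  | nil =>
    rcases L' with _ | ⟨a, L'⟩
    · simp
    · obtain ⟨t, ht, -⟩ := hc' a mem_cons_self
      simp [ht] at h
  | cons a L ih =>
    rw [pairwise_cons] at hL
    rw [forall_mem_cons] at hc
    obtain ⟨t, ht, hat⟩ := hc.1
    rcases L' with _ | ⟨a', L'⟩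
    · simp [ht] at h
    rw [pairwise_cons] at hL'
    rw [forall_mem_cons] at hc'
    obtain ⟨t', ht', hat'⟩ := hc'.1
    rw [map_cons, map_cons, flatten_cons, flatten_cons, ht, ht', cons_append, cons_append,
      cons.injEq] at h
    obtain ⟨rfl, h⟩ := h
    have key : ∀ (M : List (Fin n)) (d : Fin n → List (Fin n)), (∀ b ∈ M, b < a) →
        (∀ b ∈ M, ∃ t, d b = b :: t ∧ ∀ x ∈ t, b < x) →
        ((M.map d).flatten).takeWhile (a < ·) = [] := by
      rintro (_ | ⟨b, M⟩) d hM hd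
      · rfl
      · obtain ⟨s, hs, -⟩ := hd b mem_cons_self
        simp [hs, (hM b mem_cons_self).le]
    have h1 := congrArg (takeWhile (a < ·)) h
    rw [takeWhile_append_of_pos (by simpa using hat), takeWhile_append_of_pos (by simpa using hat'),
      key L c hL.1 hc.2, key L' c' hL'.1 hc'.2, append_nil, append_nil] at h1
    subst h1
    obtain ⟨rfl, h2⟩ := ih hL.2 hc.2 hL'.2 hc'.2 (append_cancel_left h)
    exact ⟨rfl, forall_mem_cons.2 ⟨ht.trans ht'.symm, h2⟩⟩

lemma lrMinima_cycleFormWord {n : ℕ} (π : Equiv.Perm (Fin n)) :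
    lrMinima n ((cycleFormWord π).map Fin.val) = numCycles π := by
  rw [cycleFormWord_eq, numCycles_eq]
  exact lrMinima_flatten (pairwise_cycleMins π)
    (fun a ha => ((mem_cycleMins π).1 ha).exists_cycleWord_eq_cons) fun a _ => a.2

lemma apply_eq_of_cycleWord_eq {n : ℕ} {π σ : Equiv.Perm (Fin n)} {a x : Fin n}
    (h : cycleWord π a = cycleWord σ a) (hx : π.SameCycle a x) : π x = σ x := by
  have hcard := congrArg length h
  rw [cycleWord, cycleWord, length_iterate, length_iterate] at hcard
  have hlt : ∀ i < (Finset.univ.filter fun b => π.SameCycle a b).card, π^[i] a = σ^[i] a := by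
    intro i hi
    have h1 := congrArg (fun l => l[i]?) h
    simp only [cycleWord] at h1
    rw [getElem?_iterate _ _ _ _ hi, getElem?_iterate _ _ _ _ (hcard ▸ hi)] at h1
    exact Option.some.inj h1
  -- The value `i` equal to the cycle length is needed for the last entry of the cycle, which both
  -- permutations send back to `a`.
  have hle : ∀ i ≤ (Finset.univ.filter fun b => π.SameCycle a b).card, π^[i] a = σ^[i] a := by
    intro i hi
    rcases hi.lt_or_eq with hi | rfl
    · exact hlt i hi
    · rw [← Equiv.Perm.coe_pow, (isCycleOn_filter_sameCycle π a).pow_card_apply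
        (mem_filter_sameCycle_self π a), hcard, ← Equiv.Perm.coe_pow,
        (isCycleOn_filter_sameCycle σ a).pow_card_apply (mem_filter_sameCycle_self σ a)]
  rw [← mem_cycleWord, cycleWord, mem_iterate] at hx
  obtain ⟨i, hi, rfl⟩ := hx
  rw [← Function.iterate_succ_apply' π, hle _ hi, Function.iterate_succ_apply', hlt i hi]

lemma cycleFormWord_injective {n : ℕ} :
    Function.Injective (cycleFormWord : Equiv.Perm (Fin n) → List (Fin n)) := by
  intro π σ h
  obtain ⟨-, hc⟩ := eq_of_flatten_eq (pairwise_cycleMins π)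
    (fun a ha => ((mem_cycleMins π).1 ha).exists_cycleWord_eq_cons) (pairwise_cycleMins σ)
    (fun a ha => ((mem_cycleMins σ).1 ha).exists_cycleWord_eq_cons) h
  ext x
  obtain ⟨a, ha, hx⟩ := exists_isCycleMin_sameCycle π x
  rw [apply_eq_of_cycleWord_eq (hc a ((mem_cycleMins π).2 ha)) hx]

lemma map_val_cycleFormWord_injective {n : ℕ} :
    Function.Injective fun π : Equiv.Perm (Fin n) => (cycleFormWord π).map Fin.val :=
  (map_injective_iff.2 Fin.val_injective).comp cycleFormWord_injective

lemma exists_map_val_cycleFormWord_eq {n : ℕ} {w : List ℕ} (hw : w ~ range' 0 n) :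
    ∃ π : Equiv.Perm (Fin n), (cycleFormWord π).map Fin.val = w := by
  have himage : Finset.univ.image (fun π : Equiv.Perm (Fin n) => (cycleFormWord π).map Fin.val) =
      (range' 0 n).permutations.toFinset := by
    -- No inverse is built: an injective map between sets of `n!` elements is onto.
    refine Finset.eq_of_subset_of_card_le (fun v hv => ?_) ?_
    · obtain ⟨π, -, rfl⟩ := Finset.mem_image.1 hv
      rw [mem_toFinset, mem_permutations]
      exact map_val_cycleFormWord_perm π
    · rw [Finset.card_image_of_injective _ map_val_cycleFormWord_injective, Finset.card_univ,
        Fintype.card_perm, Fintype.card_fin,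
        toFinset_card_of_nodup (nodup_permutations _ nodup_range'), length_permutations,
        length_range']
  have hmem : w ∈ (range' 0 n).permutations.toFinset := by
    rwa [mem_toFinset, mem_permutations]
  rw [← himage, Finset.mem_image] at hmem
  obtain ⟨π, -, h⟩ := hmem
  exact ⟨π, h⟩

/-! ### From pattern occurrences to conditions on triples of letters -/

lemma cyclicallyAvoids_iff_triplewise {n : ℕ} (p : Fin 3 → ℕ) (π : Equiv.Perm (Fin n)) :
    CyclicallyAvoids p π ↔ ((cycleFormWord π).map Fin.val).Triplewise
      fun x y z => ¬ ∀ i j, ![x, y, z] i < ![x, y, z] j ↔ p i < p j := by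
  rw [triplewise_map, triplewise_iff_getElem, CyclicallyAvoids]
  have hval : ∀ s : Fin 3 → Fin (cycleFormWord π).length, ∀ i,
      ![((cycleFormWord π)[s 0]).val, ((cycleFormWord π)[s 1]).val, ((cycleFormWord π)[s 2]).val] i
        = ((cycleFormWord π).get (s i)).val := by
    intro s i
    fin_cases i <;> rfl
  constructor
  · intro h i j k hij hjk hk hocc
    have hs : StrictMono (![⟨i, by omega⟩, ⟨j, by omega⟩, ⟨k, hk⟩] :
        Fin 3 → Fin (cycleFormWord π).length) := by
      rw [Fin.strictMono_iff_lt_succ]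
      intro a
      fin_cases a
      · exact hij
      · exact hjk
    refine h (OrderEmbedding.ofStrictMono _ hs) fun a b => ?_
    rw [Fin.lt_def, ← hval, ← hval]
    exact hocc a b
  · intro h s hocc
    refine h (s 0) (s 1) (s 2) (s.strictMono (by decide)) (s.strictMono (by decide)) (s 2).2 ?_
    intro a b
    rw [← hocc a b]
    exact iff_of_eq (congrArg₂ (· < ·) (hval s a) (hval s b))

lemma avoidanceCount_eq_card_words (p : Fin 3 → ℕ) {R : ℕ → ℕ → ℕ → Prop}
    (hR : ∀ x y z, (∀ i j, ![x, y, z] i < ![x, y, z] j ↔ p i < p j) ↔ ¬ R x y z) (m n : ℕ) :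
    avoidanceCount p m n =
      Nat.card {w : List ℕ // w ~ range' 0 n ∧ lrMinima n w = m ∧ w.Triplewise R} := by
  have hmem : ∀ π : Equiv.Perm (Fin n), CyclicallyAvoids p π ↔
      ((cycleFormWord π).map Fin.val).Triplewise R := by
    intro π
    simp only [cyclicallyAvoids_iff_triplewise, hR, not_not]
  refine Nat.card_congr (Equiv.ofBijective
    (fun π => ⟨(cycleFormWord π.1).map Fin.val, map_val_cycleFormWord_perm π.1,
      (lrMinima_cycleFormWord π.1).trans π.2.1, (hmem π.1).1 π.2.2⟩) ⟨?_, ?_⟩)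
  · exact fun π σ h => Subtype.ext (map_val_cycleFormWord_injective (congrArg Subtype.val h))
  · rintro ⟨w, hw, hm, hR⟩
    obtain ⟨π, rfl⟩ := exists_map_val_cycleFormWord_eq hw
    exact ⟨⟨π, (lrMinima_cycleFormWord π).symm.trans hm, (hmem π).2 hR⟩, rfl⟩

end CyclicPattern

theorem mainTheorem6 (m n : ℕ) :
    CyclicPattern.avoidanceCount ![3, 1, 2] m n = CyclicPattern.dyckReturnCount m n ∧
    CyclicPattern.avoidanceCount ![2, 3, 1] m n = CyclicPattern.dyckReturnCount m n ∧
    CyclicPattern.avoidanceCount ![2, 1, 3] m n = CyclicPattern.dyckReturnCount m n ∧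
    (m < 2 * n →
      (CyclicPattern.dyckReturnCount m n : ℚ) =
        (m : ℚ) / (2 * (n : ℚ) - (m : ℚ)) * ((2 * n - m).choose n : ℚ)) := by
  rw [CyclicPattern.dyckReturnCount_eq]
  refine ⟨?_, ?_, ?_, CyclicPattern.card_spineTrees_eq_div m n⟩
  · rw [CyclicPattern.avoidanceCount_eq_card_words _ ?_, CyclicPattern.card_avoids312]
    intro x y z
    -- The comparisons over all pairs `i`, `j` reduce to linear inequalities between the three
    -- letters.
    simp [Fin.forall_fin_succ]
    omega
  · rw [CyclicPattern.avoidanceCount_eq_card_words _ ?_, CyclicPattern.card_avoids231]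
    intro x y z
    simp [Fin.forall_fin_succ]
    omega
  · rw [CyclicPattern.avoidanceCount_eq_card_words _ ?_, CyclicPattern.card_avoids213]
    intro x y z
    simp [Fin.forall_fin_succ]
    omega
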